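/- Let $M$ be a right-angled Coxeter matrix over an index set $I$ (all off-diagonal entries are $2$ or $\infty$), and let $\Delta$ be a semiregular building of type $M$ with parameters $(q_i)_{i\in I}$, i.e. each $i$-panel has exactly $q_i$ chambers. Let $\Omega_i$ be a set of cardinality $q_i$ for each $i \in I$, and let $\lambda = (\lambda_i)_{i\in I}\colon \Delta \to \prod_{i \in I}\Omega_i$ be a legal coloring: for each $i$-panel $\mathcal P$, the restriction $\lambda_i|_{\mathcal P}\colon \mathcal P\to\Omega_i$ is a bijection, and $\lambda_j|_{\mathcal P}$ is constant for every $j\neq i$. For a (type-preserving) automorphism $g\in\operatorname{Aut}(\Delta)$ and an $i$-panel $\mathcal P$, the local action of $g$ at $\mathcal P$ is the permutation $\sigma_\lambda(g,\mathcal P)=\lambda_i|_{g\mathcal P}\circ g|_{\mathcal P}\circ(\lambda_i|_{\mathcal P})^{-1}$ of $\Omega_i$. Let $F_i\leq\operatorname{Sym}(\Omega_i)$ be a permutation group for each $i \in I$. Two chambers $c,c'$ are called harmonious if, for each $i\in I$, the colors $\lambda_i(c)$ and $\lambda_i(c')$ lie in the same orbit of $F_i$. Two panels $\mathcal P,\mathcal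 P'$ are parallel if $\operatorname{proj}_{\mathcal P}(\mathcal P')=\mathcal P$ and $\operatorname{proj}_{\mathcal P'}(\mathcal P)=\mathcal P'$, where $\operatorname{proj}$ sends a chamber to the unique closest chamber of the panel. A set $C$ of chambers is panel-closed if it is convex (all chambers on all minimal galleries between two chambers of $C$ lie in $C$) and each panel containing at least two chambers of $C$ is completely contained in $C$. Let $C\subseteq\Delta$ be panel-closed, and let $g\in\operatorname{Aut}(\Delta)$ be such that $c$ and $gc$ are harmonious for every $c\in C$. Then there exists $h\in\operatorname{Aut}(\Delta)$ such that: 1. $h|_C=g|_C$; 2. for each $i\in I$ and each $i$-panel $\mathcal P$, either $\mathcal P$ is parallel to a panel contained in $C$, or $\sigma_\lambda(h,\mathcal P)\in F_i$ (or both); 3. $c$ and $hc$ are harmonious for every chamber $c$ of $\Delta$. -/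

import Mathlib

noncomputable section

/-- A Coxeter matrix is right-angled when all its off-diagonal entries are `2` or `∞`
(Mathlib encodes `∞` as `0`; the diagonal entries are `1`). -/
def CoxeterMatrix.IsRightAngled {I : Type*} (M : CoxeterMatrix I) : Prop :=
  ∀ i j : I, i ≠ j → M i j = 2 ∨ M i j = 0

/-- A building of type `M` with set of chambers `Δ`, given by its Weyl distance
`δ : Δ × Δ → W` (a `W`-metric space). -/
structure Building {I W : Type*} [Group W] {M : CoxeterMatrix I} (cs : CoxeterSystem M W)
    (Δ : Type*) where
  nonempty : Nonempty Δ
  /-- the Weyl distance -/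
  δ : Δ → Δ → W
  δ_eq_one_iff : ∀ c d : Δ, δ c d = 1 ↔ c = d
  δ_of_adj : ∀ (i : I) (c c' d : Δ), δ c' c = cs.simple i →
    δ c' d = cs.simple i * δ c d ∨ δ c' d = δ c d
  δ_of_adj_of_length : ∀ (i : I) (c c' d : Δ), δ c' c = cs.simple i →
    cs.length (cs.simple i * δ c d) = cs.length (δ c d) + 1 →
    δ c' d = cs.simple i * δ c d
  exists_adj : ∀ (i : I) (c d : Δ), ∃ c' : Δ, δ c' c = cs.simple i ∧
    δ c' d = cs.simple i * δ c d

namespace Building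

variable {I W Δ : Type*} [Group W] {M : CoxeterMatrix I} {cs : CoxeterSystem M W}

/-- The numerical distance between two chambers. -/
def dist (X : Building cs Δ) (c d : Δ) : ℕ := cs.length (X.δ c d)

/-- The `i`-panel of the chamber `c`: all chambers that are equal to `c` or `i`-adjacent to `c`. -/
def panel (X : Building cs Δ) (i : I) (c : Δ) : Set Δ :=
  {d | X.δ c d = 1 ∨ X.δ c d = cs.simple i}

/-- `P` is an `i`-panel. -/
def IsPanel (X : Building cs Δ) (i : I) (P : Set Δ) : Prop := ∃ c : Δ, P = X.panel i c

/-- `γ = (v₀, …, v_ℓ)` is a gallery from `c` to `d`: its first chamber is `c`, its last chamber is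
`d`, and any two consecutive chambers are (distinct and) `i`-adjacent for some `i`. -/
def IsGallery (X : Building cs Δ) (c d : Δ) (γ : List Δ) : Prop :=
  γ.head? = some c ∧ γ.getLast? = some d ∧ γ.IsChain (fun x y => ∃ i : I, X.δ x y = cs.simple i)

/-- A gallery from `c` to `d` is minimal if no gallery from `c` to `d` is shorter. -/
def IsMinimalGallery (X : Building cs Δ) (c d : Δ) (γ : List Δ) : Prop :=
  X.IsGallery c d γ ∧ ∀ γ' : List Δ, X.IsGallery c d γ' → γ.length ≤ γ'.length

/-- A set of chambers is convex if it contains all chambers of all minimal galleries between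
its members. -/
def IsConvex (X : Building cs Δ) (C : Set Δ) : Prop :=
  ∀ c ∈ C, ∀ d ∈ C, ∀ γ : List Δ, X.IsMinimalGallery c d γ → ∀ e ∈ γ, e ∈ C

/-- A set of chambers is panel-closed if it is convex and contains every panel that has at least
two chambers in common with it. -/
def IsPanelClosed (X : Building cs Δ) (C : Set Δ) : Prop :=
  X.IsConvex C ∧
    ∀ (i : I) (P : Set Δ), X.IsPanel i P → (∃ x ∈ P ∩ C, ∃ y ∈ P ∩ C, x ≠ y) → P ⊆ C

/-- `d` is the projection of `c` on `R`: the unique chamber of `R` closest to `c`. -/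
def IsProj (X : Building cs Δ) (R : Set Δ) (c d : Δ) : Prop :=
  d ∈ R ∧ ∀ e ∈ R, e ≠ d → X.dist c d < X.dist c e

/-- The set `proj_R(S)` of all projections on `R` of chambers of `S`. -/
def projSet (X : Building cs Δ) (R S : Set Δ) : Set Δ := {d | ∃ c ∈ S, X.IsProj R c d}

/-- Two panels (or residues) are parallel if each of them projects onto the other. -/
def Parallel (X : Building cs Δ) (R S : Set Δ) : Prop :=
  X.projSet R S = R ∧ X.projSet S R = S

/-- The group of (type-preserving) automorphisms of the building: the permutations of the set of
chambers that preserve the Weyl distance. -/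
def aut (X : Building cs Δ) : Subgroup (Equiv.Perm Δ) where
  carrier := {g | ∀ c d : Δ, X.δ (g c) (g d) = X.δ c d}
  mul_mem' := by
    intro a b ha hb c d
    rw [Equiv.Perm.mul_apply, Equiv.Perm.mul_apply, ha, hb]
  one_mem' := fun _ _ => rfl
  inv_mem' := by
    intro a ha c d
    have h := ha (a⁻¹ c) (a⁻¹ d)
    simpa using h.symm

theorem IsPanel.image {X : Building cs Δ} {i : I} {P : Set Δ} (hP : X.IsPanel i P) (g : X.aut) :
    X.IsPanel i (g.1 '' P) := by
  obtain ⟨c, rfl⟩ := hP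
  refine ⟨g.1 c, Set.ext fun d => ?_⟩
  constructor
  · rintro ⟨e, he, rfl⟩
    simpa [panel, g.2 c e] using he
  · intro hd
    refine ⟨g.1.symm d, ?_, by simp⟩
    have h := g.2 c (g.1.symm d)
    rw [Equiv.apply_symm_apply] at h
    simpa [panel, h] using hd

/-- A legal coloring of the building with color sets `Ω i`. By the first property every `i`-panel
has exactly as many chambers as `Ω i` has elements, so the building is semiregular with
parameters `q i = |Ω i|`. -/
structure LegalColoring (X : Building cs Δ) (Ω : I → Type*) where
  /-- the `i`-color of a chamber -/
  color : (i : I) → Δ → Ω i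
  bijOn : ∀ (i : I) (P : Set Δ), X.IsPanel i P → Set.BijOn (color i) P Set.univ
  constant : ∀ (i j : I), j ≠ i → ∀ P : Set Δ, X.IsPanel i P →
    ∀ c ∈ P, ∀ d ∈ P, color j c = color j d

namespace LegalColoring

variable {X : Building cs Δ} {Ω : I → Type*}

/-- The bijection `P → Ω i` given by the `i`-colors on an `i`-panel `P`. -/
def panelEquiv (col : X.LegalColoring Ω) {i : I} {P : Set Δ} (hP : X.IsPanel i P) : P ≃ Ω i :=
  ((col.bijOn i P hP).equiv (col.color i)).trans (Equiv.Set.univ (Ω i))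

/-- The local action of the automorphism `g` at the `i`-panel `P`: the permutation
`λ_i|_{gP} ∘ g|_P ∘ (λ_i|_P)⁻¹` of `Ω i`. -/
def localAction (col : X.LegalColoring Ω) (g : X.aut) {i : I} {P : Set Δ} (hP : X.IsPanel i P) :
    Equiv.Perm (Ω i) :=
  ((col.panelEquiv hP).symm.trans (g.1.image P)).trans (col.panelEquiv (hP.image g))

/-- Two chambers are harmonious with respect to the local data `F` if for each `k` their
`k`-colors lie in the same orbit of the local group `F k`. -/
def Harmonious (col : X.LegalColoring Ω) (F : (i : I) → Subgroup (Equiv.Perm (Ω i)))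
    (c d : Δ) : Prop :=
  ∀ k : I, col.color k d ∈ MulAction.orbit (F k) (col.color k c)

end LegalColoring

end Building

end

/-!
The automorphism `h` is built outwards from `C`. A panel-closed set `C` in a right-angled building
is gated: every chamber `d` has a projection `π d` on `C`, through which all chambers of `C` can be
reached by minimal galleries from `d` (`Building.IsPanelClosed.exists_isGate`). The distance to
`π d` serves as a rank. On `C` let `h = g`. If `p` is `i`-adjacent to `d` and one step closer to `C`
(`Building.IsLower`), let `h d` be the chamber in the `i`-panel of `h p` whose `i`-color is
`σ (λ_i d)`, where `σ = f i (λ_i p) (λ_i (h p))` is a chosen element of `F i` that moves the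
`i`-color of `p` to that of `h p`. Such an element exists because `p` and `h p` are harmonious, a
property which this rule transports from `p` to `d`.

The rule is independent of the choice of `p`: two different steps `p`, `q` from `d` towards `C`
have commuting types `i`, `j` and are completed to a square by a chamber two steps closer to `C`
(`Building.IsLower.diamond`), and in the square the `i`- and the `j`-color can be changed
independently (`Building.LegalColoring.recolor_recolor_comm`).

For the local action of `h` at a panel there are two cases. Either the panel has a single chamber
closest to `C`, and then the rule shows that `h` acts on the colors as an element of `F i`; or all
its chambers are at the same distance from `C`. In the second case the panel is parallel to a
panel in `C` (`Building.IsTransverse.parallel`), and `h` acts on it as `g` does on that panel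
of `C`, as one sees by moving it towards `C` through commuting squares
(`Building.IsTransverse.exists_lower`). So `h` acts on every panel by a permutation of colors,
which makes it an automorphism (`Building.LegalColoring.mem_aut_of_local`).

All of this rests on one fact about a right-angled Coxeter group: two distinct descents of an
element commute and can both be removed (`CoxeterSystem.two_left_descents`). It is derived from
the action of the group on signed reflections, which yields the strong exchange property, together
with the fact that alternating products of two simple reflections with product of infinite order
are reduced.
-/

namespace CoxeterSystem

variable {I W : Type*} [Group W] {M : CoxeterMatrix I}

/-! ### Right-angled Coxeter groups: lifting maps, and the inversion parity -/

theorem simple_ne_one (cs : CoxeterSystem M W) (i : I) :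
    cs.simple i ≠ 1 := by
  intro h
  have h1 := cs.length_simple i
  rw [h, cs.length_one] at h1
  omega

theorem simple_mul_simple_comm_of_eq_two (cs : CoxeterSystem M W) {i j : I} (h : M i j = 2) :
    cs.simple i * cs.simple j = cs.simple j * cs.simple i := by
  have h1 := cs.simple_mul_simple_pow i j
  rw [h, pow_two] at h1
  have h2 := eq_inv_of_mul_eq_one_left h1
  rwa [mul_inv_rev, cs.inv_simple, cs.inv_simple] at h2

/-- To extend a map from the simple reflections of a right-angled Coxeter group to a monoid, it
suffices that it sends them to involutions and sends commuting pairs to commuting pairs. -/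
theorem isLiftable_of_isRightAngled (hM : M.IsRightAngled) {G : Type*} [Monoid G] {f : I → G}
    (hsq : ∀ i, f i * f i = 1)
    (hcomm : ∀ i j, i ≠ j → M i j = 2 → f i * f j = f j * f i) : M.IsLiftable f := by
  intro i j
  by_cases hij : i = j
  · subst hij
    rw [M.diagonal, pow_one, hsq]
  · rcases hM i j hij with h | h
    · rw [h, pow_two, mul_assoc, ← mul_assoc (f j), ← hcomm i j hij h, mul_assoc (f i) (f j), hsq,
        mul_one, hsq]
    · rw [h, pow_zero]

theorem simple_injective_of_isRightAngled (cs : CoxeterSystem M W) (hM : M.IsRightAngled) :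
    Function.Injective cs.simple := by
  classical
  intro i j hij
  by_contra hne
  let f : I → Multiplicative (ZMod 2) := fun k => if k = i then Multiplicative.ofAdd 1 else 1
  have hf : M.IsLiftable f := by
    refine isLiftable_of_isRightAngled hM (fun k => ?_) (fun _ _ _ _ => mul_comm _ _)
    by_cases h : k = i
    · simp only [f, if_pos h]; decide
    · simp [f, if_neg h]
  have h1 := cs.lift_apply_simple hf i
  rw [hij, cs.lift_apply_simple hf j] at h1
  simp only [f, if_neg (Ne.symm hne), if_true] at h1
  exact absurd h1 (by decide)

open Classical in
/-- The endomap `(t, ε) ↦ (s t s, ε + [t = s])` of `W × ℤ/2` attached to a simple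
reflection `s`. -/
noncomputable def signedConj (cs : CoxeterSystem M W) (i : I) :
    Function.End (W × ZMod 2) := fun p =>
  (cs.simple i * p.1 * cs.simple i, p.2 + if p.1 = cs.simple i then 1 else 0)

theorem isLiftable_signedConj (cs : CoxeterSystem M W) (hM : M.IsRightAngled) :
    M.IsLiftable cs.signedConj := by
  classical
  have hconj : ∀ (i j : I) (t : W), cs.simple i * cs.simple j = cs.simple j * cs.simple i →
      (cs.simple i * t * cs.simple i = cs.simple j ↔ t = cs.simple j) := by
    intro i j t h
    constructor
    · intro h1
      have h2 : t = cs.simple i * (cs.simple i * t * cs.simple i) * cs.simple i := by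
        simp [mul_assoc]
      rw [h2, h1, h, mul_assoc]
      simp
    · rintro rfl
      rw [h, mul_assoc]
      simp
  refine isLiftable_of_isRightAngled hM (fun i => ?_) (fun i j _ h2 => ?_)
  · funext p
    change cs.signedConj i (cs.signedConj i p) = p
    have h2 : (2 : ZMod 2) = 0 := rfl
    simp only [signedConj, hconj i i p.1 rfl]
    ext
    · simp [mul_assoc]
    · by_cases h : p.1 = cs.simple i
      · simp [h, add_assoc, one_add_one_eq_two, h2]
      · simp [h]
  · have hc := cs.simple_mul_simple_comm_of_eq_two h2
    funext p
    change cs.signedConj i (cs.signedConj j p) = cs.signedConj j (cs.signedConj i p)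
    simp only [signedConj, hconj i j p.1 hc, hconj j i p.1 hc.symm]
    ext
    · simp only
      simp only [mul_assoc]
      rw [hc, ← mul_assoc, hc, mul_assoc]
    · simp only
      ring

/-- The action of the Coxeter group `W` on `W × ℤ/2` through which each simple reflection `s`
acts by `(t, ε) ↦ (s t s, ε + [t = s])`. -/
noncomputable def signedConjHom (cs : CoxeterSystem M W) (hM : M.IsRightAngled) :
    W →* Function.End (W × ZMod 2) :=
  cs.lift ⟨cs.signedConj, cs.isLiftable_signedConj hM⟩

/-- The parity of the number of times that `t` occurs in the left inversion sequence of a word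
for `w`. For a reflection `t` it is `1` exactly if `t` is a left inversion of `w`. -/
noncomputable def inversionParity (cs : CoxeterSystem M W) (hM : M.IsRightAngled) (w t : W) :
    ZMod 2 :=
  (cs.signedConjHom hM w⁻¹ (t, 0)).2

theorem signedConjHom_simple (cs : CoxeterSystem M W) (hM : M.IsRightAngled) (i : I) :
    cs.signedConjHom hM (cs.simple i) = cs.signedConj i :=
  cs.lift_apply_simple (cs.isLiftable_signedConj hM) i

theorem signedConjHom_inv_apply (cs : CoxeterSystem M W) (hM : M.IsRightAngled) (w t : W)
    (ε : ZMod 2) :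
    cs.signedConjHom hM w⁻¹ (t, ε) = (w⁻¹ * t * w, ε + cs.inversionParity hM w t) := by
  classical
  have key : ∀ w : W, ∀ (t : W) (ε : ZMod 2), cs.signedConjHom hM w (t, ε) =
      (w * t * w⁻¹, ε + (cs.signedConjHom hM w (t, 0)).2) := by
    intro w
    induction w using cs.simple_induction_left with
    | one =>
      intro t ε
      rw [map_one]
      change (t, ε) = (1 * t * 1⁻¹, ε + 0)
      simp
    | mul_simple_left w i ih =>
      intro t ε
      have h : ∀ p, cs.signedConjHom hM (cs.simple i * w) p =
          cs.signedConj i (cs.signedConjHom hM w p) := by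
        intro p
        rw [map_mul, signedConjHom_simple]
        rfl
      rw [h, h, ih t ε, ih t 0]
      simp only [signedConj]
      ext
      · simp [mul_assoc]
      · simp only
        ring
  rw [key]
  simp [inversionParity]

theorem inversionParity_mul (cs : CoxeterSystem M W) (hM : M.IsRightAngled) (v w t : W) :
    cs.inversionParity hM (v * w) t =
      cs.inversionParity hM v t + cs.inversionParity hM w (v⁻¹ * t * v) := by
  have h : cs.signedConjHom hM (v * w)⁻¹ (t, 0) =
      cs.signedConjHom hM w⁻¹ (cs.signedConjHom hM v⁻¹ (t, 0)) := by
    rw [mul_inv_rev, map_mul]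
    rfl
  have h2 := congrArg Prod.snd h
  rw [signedConjHom_inv_apply, signedConjHom_inv_apply, signedConjHom_inv_apply] at h2
  simpa using h2

open Classical in
theorem inversionParity_simple (cs : CoxeterSystem M W) (hM : M.IsRightAngled) (i : I) (t : W) :
    cs.inversionParity hM (cs.simple i) t = if t = cs.simple i then 1 else 0 := by
  rw [inversionParity, cs.inv_simple, signedConjHom_simple]
  simp [signedConj]

/-- One half of the strong exchange property: if `t` occurs an odd number of times in the left
inversion sequence of a word for `w`, multiplication by `t` shortens `w`. -/
theorem length_mul_lt_of_inversionParity_ne_zero (cs : CoxeterSystem M W) (hM : M.IsRightAngled)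
    (w t : W) (h : cs.inversionParity hM w t ≠ 0) : cs.length (t * w) < cs.length w := by
  classical
  induction hn : cs.length w generalizing w t with
  | zero =>
    rw [cs.length_eq_zero_iff] at hn
    subst hn
    simp [inversionParity] at h
    exact absurd rfl h
  | succ n ih =>
    have hw : w ≠ 1 := by
      rintro rfl
      simp at hn
    obtain ⟨i, hi⟩ := cs.exists_leftDescent_of_ne_one hw
    rw [isLeftDescent_iff] at hi
    have hw2 : w = cs.simple i * (cs.simple i * w) := by simp
    have h1 : cs.inversionParity hM w t = (if t = cs.simple i then 1 else 0) +
        cs.inversionParity hM (cs.simple i * w) (cs.simple i * t * cs.simple i) := by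
      conv_lhs => rw [hw2]
      rw [inversionParity_mul, inversionParity_simple, cs.inv_simple]
    by_cases ht : t = cs.simple i
    · rw [ht]; omega
    · rw [h1, if_neg ht, zero_add] at h
      have h2 := ih _ _ h (by omega)
      have h3 : t * w = cs.simple i *
          (cs.simple i * t * cs.simple i * (cs.simple i * w)) := by simp [mul_assoc]
      have h4 := cs.length_mul_le (cs.simple i)
        (cs.simple i * t * cs.simple i * (cs.simple i * w))
      rw [← h3, cs.length_simple] at h4
      omega

theorem inversionParity_simple_right (cs : CoxeterSystem M W) (hM : M.IsRightAngled) {w : W}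
    {i : I} (h : cs.length (cs.simple i * w) < cs.length w) :
    cs.inversionParity hM w (cs.simple i) = 1 := by
  classical
  have h1 : cs.inversionParity hM (cs.simple i * w) (cs.simple i) = 0 := by
    by_contra h2
    have h3 := cs.length_mul_lt_of_inversionParity_ne_zero hM _ _ h2
    rw [cs.simple_mul_simple_cancel_left] at h3
    omega
  have h2 := cs.inversionParity_mul hM (cs.simple i) (cs.simple i * w) (cs.simple i)
  rw [cs.simple_mul_simple_cancel_left, inversionParity_simple, if_pos rfl, cs.inv_simple] at h2
  simpa [h1] using h2

/-! ### Alternating products and pairs of descents -/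

/-- The alternating product `s i * s j * s i * ⋯` with `k` factors. -/
def altProd (cs : CoxeterSystem M W) : ℕ → I → I → W
  | 0, _, _ => 1
  | k + 1, i, j => cs.simple i * altProd cs k j i

/-- If `s i * s j` has infinite order, alternating products are reduced. The reason is the action
of `W` on `ℤ` in which `s i` and `s j` are the reflections `x ↦ 1 - x` and `x ↦ -1 - x` and all
other simple reflections act trivially: `w` moves `0` by at most its length, and an alternating
product with `k` factors moves it to `k` or `-k`. -/
theorem le_length_altProd (cs : CoxeterSystem M W) (hM : M.IsRightAngled) {i j : I} (hij : i ≠ j)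
    (h0 : M i j = 0) (k : ℕ) : k ≤ cs.length (cs.altProd k i j) := by
  classical
  let f : I → Function.End ℤ := fun a =>
    if a = i then fun x => 1 - x else if a = j then fun x => -1 - x else 1
  have fi : f i = fun x => 1 - x := if_pos rfl
  have fj : f j = fun x => -1 - x := (if_neg hij.symm).trans (if_pos rfl)
  have fo : ∀ a, a ≠ i → a ≠ j → f a = 1 := fun a ha hb => by simp [f, ha, hb]
  have hf : M.IsLiftable f := by
    refine isLiftable_of_isRightAngled hM (fun a => ?_) (fun a b hab h2 => ?_)
    · by_cases ha : a = i
      · subst ha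
        rw [fi]; funext x
        change 1 - (1 - x) = x
        ring
      · by_cases hb : a = j
        · subst hb
          rw [fj]; funext x
          change -1 - (-1 - x) = x
          ring
        · rw [fo a ha hb, one_mul]
    · by_cases ha : a = i
      · by_cases hb : b = j
        · rw [ha, hb, h0] at h2
          omega
        · rw [fo b (fun h => hab (ha.trans h.symm)) hb, one_mul, mul_one]
      · by_cases ha' : a = j
        · by_cases hb : b = i
          · rw [ha', hb, M.symmetric, h0] at h2
            omega
          · rw [fo b hb (fun h => hab (ha'.trans h.symm)), one_mul, mul_one]
        · rw [fo a ha ha', one_mul, mul_one]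
  let ψ : W →* Function.End ℤ := cs.lift ⟨f, hf⟩
  have hψ : ∀ a, ψ (cs.simple a) = f a := cs.lift_apply_simple hf
  have hmul : ∀ (a : I) (w : W) (x : ℤ), ψ (cs.simple a * w) x = f a (ψ w x) := by
    intro a w x
    rw [map_mul, hψ]
    rfl
  have hle : ∀ (n : ℕ) (w : W), cs.length w = n → |ψ w 0| ≤ n := by
    intro n
    induction n with
    | zero =>
      intro w hw
      rw [cs.length_eq_zero_iff] at hw
      subst hw
      rw [map_one]
      change |(0 : ℤ)| ≤ _
      simp
    | succ n ih =>
      intro w hw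
      have hw1 : w ≠ 1 := by
        rintro rfl
        simp at hw
      obtain ⟨a, ha⟩ := cs.exists_leftDescent_of_ne_one hw1
      rw [isLeftDescent_iff] at ha
      have h1 := ih (cs.simple a * w) (by omega)
      have h2 := hmul a (cs.simple a * w) 0
      rw [cs.simple_mul_simple_cancel_left] at h2
      rw [h2]
      rw [abs_le] at h1 ⊢
      push_cast
      by_cases hb : a = i
      · rw [hb, fi]; rw [hb] at h1
        constructor <;> simp only <;> omega
      · by_cases hc : a = j
        · rw [hc, fj]; rw [hc] at h1
          constructor <;> simp only <;> omega
        · rw [fo a hb hc]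
          change _ ≤ ψ (cs.simple a * w) 0 ∧ ψ (cs.simple a * w) 0 ≤ _
          omega
  have halt : ∀ k : ℕ, ψ (cs.altProd k i j) 0 = k ∧ ψ (cs.altProd k j i) 0 = -k := by
    intro k
    induction k with
    | zero =>
      simp only [altProd, map_one]
      exact ⟨rfl, rfl⟩
    | succ k ih =>
      simp only [altProd, hmul, fi, fj, ih.1, ih.2]
      push_cast
      constructor <;> ring
  have h1 := hle _ _ (rfl : cs.length (cs.altProd k i j) = _)
  rw [(halt k).1, Nat.abs_cast] at h1
  exact_mod_cast h1

theorem length_altProd_le (cs : CoxeterSystem M W) (k : ℕ) (i j : I) :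
    cs.length (cs.altProd k i j) ≤ k := by
  induction k generalizing i j with
  | zero => simp [altProd]
  | succ k ih =>
    have h1 := cs.length_mul_le (cs.simple i) (cs.altProd k j i)
    rw [cs.length_simple] at h1
    have h2 := ih j i
    simp only [altProd]
    omega

/-- Two distinct left descents of an element of a right-angled Coxeter group commute, and both
can be removed. If `s i * s j` had infinite order, arbitrarily long alternating products could be
split off on the left of `w`. -/
theorem two_left_descents (cs : CoxeterSystem M W) (hM : M.IsRightAngled) {w : W} {i j : I}
    (hij : i ≠ j) (hi : cs.length (cs.simple i * w) < cs.length w)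
    (hj : cs.length (cs.simple j * w) < cs.length w) :
    cs.simple i * cs.simple j = cs.simple j * cs.simple i ∧
      cs.length (cs.simple i * (cs.simple j * w)) + 2 = cs.length w := by
  classical
  rcases hM i j hij with h2 | h0
  · -- `s i` is a left inversion of `s j * w`, being fixed by conjugation with `s j`
    have hc := cs.simple_mul_simple_comm_of_eq_two h2
    refine ⟨hc, ?_⟩
    have h3 := cs.inversionParity_mul hM (cs.simple j) (cs.simple j * w) (cs.simple i)
    have h4 := cs.inversionParity_mul hM (cs.simple j) w (cs.simple i)
    rw [inversionParity_simple, if_neg, zero_add, cs.inv_simple, ← hc,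
      cs.simple_mul_simple_cancel_right, cs.inversionParity_simple_right hM hi] at h4
    · have h5 := cs.length_mul_lt_of_inversionParity_ne_zero hM (cs.simple j * w) (cs.simple i)
        (by rw [h4]; decide)
      have h6 := cs.length_simple_mul w j
      have h7 := cs.length_simple_mul (cs.simple j * w) i
      omega
    · exact fun h => hij (cs.simple_injective_of_isRightAngled hM h)
  · exfalso
    -- if `w` begins with the alternating product `s a * s b * ⋯` of `k` factors, exchange with the
    -- descent `s b` does not delete a letter of that product, since `s b * s a * ⋯` is reduced; so
    -- `w` also begins with the alternating product `s b * s a * ⋯` of `k + 1` factors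
    have step : ∀ (k : ℕ) (a b : I), a ≠ b → M a b = 0 →
        cs.length (cs.simple b * w) < cs.length w →
        cs.length ((cs.altProd k a b)⁻¹ * w) + k ≤ cs.length w →
        cs.length ((cs.altProd (k + 1) b a)⁻¹ * w) + (k + 1) ≤ cs.length w := by
      intro k a b hab h0 hb hk
      have h1 := cs.inversionParity_mul hM (cs.altProd k a b) ((cs.altProd k a b)⁻¹ * w)
        (cs.simple b)
      rw [mul_inv_cancel_left, cs.inversionParity_simple_right hM hb] at h1
      have h2 : cs.inversionParity hM (cs.altProd k a b) (cs.simple b) = 0 := by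
        by_contra h3
        have h4 := cs.length_mul_lt_of_inversionParity_ne_zero hM _ _ h3
        have h5 := cs.length_altProd_le k a b
        have h6 := cs.le_length_altProd hM hab.symm (by rw [M.symmetric, h0]) (k + 1)
        simp only [altProd] at h6
        omega
      rw [h2, zero_add] at h1
      have h3 := cs.length_mul_lt_of_inversionParity_ne_zero hM _ _
        (by rw [← h1]; decide : cs.inversionParity hM ((cs.altProd k a b)⁻¹ * w)
          ((cs.altProd k a b)⁻¹ * cs.simple b * cs.altProd k a b) ≠ 0)
      have h4 : (cs.altProd (k + 1) b a)⁻¹ * w = (cs.altProd k a b)⁻¹ * cs.simple b *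
          cs.altProd k a b * ((cs.altProd k a b)⁻¹ * w) := by
        simp only [altProd, mul_inv_rev, cs.inv_simple]
        group
      rw [h4]
      omega
    have all : ∀ k : ℕ, cs.length ((cs.altProd k i j)⁻¹ * w) + k ≤ cs.length w ∧
        cs.length ((cs.altProd k j i)⁻¹ * w) + k ≤ cs.length w := by
      intro k
      induction k with
      | zero => simp [altProd]
      | succ k ih =>
        exact ⟨step k j i hij.symm (by rw [M.symmetric, h0]) hi ih.2, step k i j hij h0 hj ih.1⟩
    have h1 := (all (cs.length w + 1)).1
    omega

theorem two_right_descents (cs : CoxeterSystem M W) (hM : M.IsRightAngled) {w : W} {i j : I}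
    (hij : i ≠ j) (hi : cs.length (w * cs.simple i) < cs.length w)
    (hj : cs.length (w * cs.simple j) < cs.length w) :
    cs.simple i * cs.simple j = cs.simple j * cs.simple i ∧
      cs.length (w * cs.simple i * cs.simple j) + 2 = cs.length w := by
  have key : ∀ k, cs.length (cs.simple k * w⁻¹) = cs.length (w * cs.simple k) := by
    intro k
    rw [← cs.length_inv (w * cs.simple k), mul_inv_rev, cs.inv_simple]
  obtain ⟨h1, h2⟩ := cs.two_left_descents hM (w := w⁻¹) hij.symm
    (by rw [key, cs.length_inv]; exact hj) (by rw [key, cs.length_inv]; exact hi)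
  refine ⟨h1.symm, ?_⟩
  rw [← cs.length_inv (w * cs.simple i * cs.simple j), mul_inv_rev, mul_inv_rev, cs.inv_simple,
    cs.inv_simple, h2, cs.length_inv]

/-- A form of the folding condition: if `s i * u = w * s j` with `u` and `w` of the same length,
and `s i` increases both lengths, then `i = j` and `u = w`. -/
theorem eq_of_simple_mul_eq_mul_simple (cs : CoxeterSystem M W) (hM : M.IsRightAngled) {u w : W}
    {i j : I} (h : cs.simple i * u = w * cs.simple j)
    (hu : cs.length (cs.simple i * u) = cs.length u + 1)
    (hw : cs.length (cs.simple i * w) = cs.length w + 1) (huw : cs.length w = cs.length u) :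
    i = j ∧ u = w := by
  induction hn : cs.length u generalizing u w with
  | zero =>
    have hu1 := cs.length_eq_zero_iff.mp hn
    have hw1 := cs.length_eq_zero_iff.mp (huw.trans hn)
    subst hu1 hw1
    rw [mul_one, one_mul] at h
    exact ⟨cs.simple_injective_of_isRightAngled hM h, rfl⟩
  | succ n ih =>
    have hu1 : u ≠ 1 := by
      rintro rfl
      simp at hn
    obtain ⟨k, hk⟩ := cs.exists_leftDescent_of_ne_one hu1
    rw [isLeftDescent_iff] at hk
    have hki : i ≠ k := by
      rintro rfl
      omega
    have h1 : cs.simple i * w = u * cs.simple j := by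
      have h2 : w = cs.simple i * u * cs.simple j := by
        rw [h, cs.simple_mul_simple_cancel_right]
      rw [h2, mul_assoc, cs.simple_mul_simple_cancel_left]
    have hlen : cs.length (cs.simple i * w) = n + 2 := by omega
    have hk2 : cs.length (cs.simple k * (cs.simple i * w)) < cs.length (cs.simple i * w) := by
      rw [h1, ← mul_assoc]
      have h3 := cs.length_mul_le (cs.simple k * u) (cs.simple j)
      rw [cs.length_simple] at h3
      rw [← h1, hlen]
      omega
    obtain ⟨hc, hl⟩ := cs.two_left_descents hM (w := cs.simple i * w) hki
      (by rw [cs.simple_mul_simple_cancel_left]; omega) hk2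
    rw [← mul_assoc, hc, mul_assoc, cs.simple_mul_simple_cancel_left] at hl
    have h5 : cs.simple i * (cs.simple k * u) = cs.simple k * w * cs.simple j := by
      rw [← mul_assoc, hc, mul_assoc, h, mul_assoc]
    have h6 : cs.length (cs.simple i * (cs.simple k * u)) = cs.length (cs.simple k * u) + 1 := by
      rcases cs.length_simple_mul (cs.simple k * u) i with h7 | h7
      · exact h7
      · rw [← mul_assoc, hc, mul_assoc] at h7
        have h8 := cs.length_simple_mul (cs.simple i * u) k
        omega
    have h9 : cs.length (cs.simple i * (cs.simple k * w)) = cs.length (cs.simple k * w) + 1 := by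
      rw [← mul_assoc, hc, mul_assoc]
      have h8 := cs.length_simple_mul (cs.simple i * w) k
      omega
    obtain ⟨h7, h8⟩ := ih h5 h6 h9 (by omega) (by omega)
    exact ⟨h7, mul_left_cancel h8⟩

end CoxeterSystem

namespace Building

variable {I W Δ : Type*} [Group W] {M : CoxeterMatrix I} {cs : CoxeterSystem M W}

/-! ### The Weyl distance along galleries -/

theorem δ_self (X : Building cs Δ) (c : Δ) : X.δ c c = 1 := (X.δ_eq_one_iff c c).2 rfl

theorem δ_simple_symm (X : Building cs Δ) {i : I} {c d : Δ} (h : X.δ c d = cs.simple i) :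
    X.δ d c = cs.simple i := by
  rcases X.δ_of_adj i d c c h with h1 | h1
  · rw [X.δ_self] at h1
    rw [← inv_eq_of_mul_eq_one_right h1.symm, cs.inv_simple]
  · rw [X.δ_self] at h1
    have h2 := (X.δ_eq_one_iff d c).1 h1.symm
    subst h2
    rw [X.δ_self] at h
    exact absurd h.symm (cs.simple_ne_one i)

theorem ne_of_δ_eq_simple (X : Building cs Δ) {i : I} {c d : Δ} (h : X.δ c d = cs.simple i) :
    c ≠ d := by
  rintro rfl
  rw [X.δ_self] at h
  exact cs.simple_ne_one i h.symm

/-- `X.HasGallery l c d` says that there is a gallery of type `l` from `c` to `d`. -/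
def HasGallery (X : Building cs Δ) : List I → Δ → Δ → Prop
  | [], c, d => c = d
  | i :: l, c, d => ∃ e, X.δ c e = cs.simple i ∧ HasGallery X l e d

theorem hasGallery_append (X : Building cs Δ) {l l' : List I} {c d : Δ} :
    X.HasGallery (l ++ l') c d ↔ ∃ e, X.HasGallery l c e ∧ X.HasGallery l' e d := by
  induction l generalizing c with
  | nil => simp [HasGallery]
  | cons i l ih =>
    simp only [List.cons_append, HasGallery, ih]
    constructor
    · rintro ⟨e, he, f, hf, hf'⟩
      exact ⟨f, ⟨e, he, hf⟩, hf'⟩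
    · rintro ⟨f, ⟨e, he, hf⟩, hf'⟩
      exact ⟨e, he, f, hf, hf'⟩

theorem HasGallery.reverse {X : Building cs Δ} {l : List I} {c d : Δ} (h : X.HasGallery l c d) :
    X.HasGallery l.reverse d c := by
  induction l generalizing c with
  | nil => exact h.symm
  | cons i l ih =>
    obtain ⟨e, he, h1⟩ := h
    rw [List.reverse_cons, hasGallery_append]
    exact ⟨e, ih h1, c, X.δ_simple_symm he, rfl⟩

theorem HasGallery.δ_eq {X : Building cs Δ} {l : List I} {c d : Δ} (h : X.HasGallery l c d)
    (hl : cs.IsReduced l) : X.δ c d = cs.wordProd l := by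
  induction l generalizing c with
  | nil =>
    obtain rfl : c = d := h
    rw [X.δ_self, cs.wordProd_nil]
  | cons i l ih =>
    obtain ⟨e, he, h1⟩ := h
    have hl' : cs.IsReduced l := hl.drop 1
    have h2 := ih h1 hl'
    rw [cs.wordProd_cons, ← h2]
    refine X.δ_of_adj_of_length i e c d he ?_
    rw [h2, ← cs.wordProd_cons, hl.eq, hl'.eq, List.length_cons]

theorem hasGallery_of_δ_eq (X : Building cs Δ) {l : List I} {c d : Δ}
    (h : X.δ c d = cs.wordProd l) : X.HasGallery l c d := by
  induction l generalizing c with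
  | nil =>
    rw [cs.wordProd_nil, X.δ_eq_one_iff] at h
    exact h
  | cons i l ih =>
    obtain ⟨e, he, h1⟩ := X.exists_adj i c d
    rw [h, cs.wordProd_cons, cs.simple_mul_simple_cancel_left] at h1
    exact ⟨e, X.δ_simple_symm he, ih h1⟩

theorem δ_inv (X : Building cs Δ) (c d : Δ) : X.δ d c = (X.δ c d)⁻¹ := by
  obtain ⟨l, hl, h⟩ := cs.exists_isReduced (X.δ c d)
  rw [(X.hasGallery_of_δ_eq h).reverse.δ_eq hl.reverse, h, cs.wordProd_reverse]

theorem length_δ_comm (X : Building cs Δ) (c d : Δ) :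
    cs.length (X.δ d c) = cs.length (X.δ c d) := by
  rw [X.δ_inv c d, cs.length_inv]

theorem δ_eq_mul_of_length (X : Building cs Δ) {c d e : Δ}
    (h : cs.length (X.δ c d * X.δ d e) = cs.length (X.δ c d) + cs.length (X.δ d e)) :
    X.δ c e = X.δ c d * X.δ d e := by
  obtain ⟨l, hl, h1⟩ := cs.exists_isReduced (X.δ c d)
  obtain ⟨l', hl', h2⟩ := cs.exists_isReduced (X.δ d e)
  rw [h1, h2, ← cs.wordProd_append]
  refine ((X.hasGallery_append).2
    ⟨d, X.hasGallery_of_δ_eq h1, X.hasGallery_of_δ_eq h2⟩).δ_eq ?_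
  rw [CoxeterSystem.IsReduced, cs.wordProd_append, ← h1, ← h2, h, List.length_append, h1, h2,
    hl.eq, hl'.eq]

/-- Any factorization of the Weyl distance, reduced or not, is realized by an intermediate
chamber. -/
theorem exists_δ_eq_and_δ_eq (X : Building cs Δ) {c e : Δ} {u v : W} (h : X.δ c e = u * v) :
    ∃ d, X.δ c d = u ∧ X.δ d e = v := by
  obtain ⟨l, hl, rfl⟩ := cs.exists_isReduced u
  obtain ⟨l', hl', rfl⟩ := cs.exists_isReduced v
  rw [← cs.wordProd_append] at h
  obtain ⟨d, h1, h2⟩ := X.hasGallery_append.1 (X.hasGallery_of_δ_eq h)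
  exact ⟨d, h1.δ_eq hl, h2.δ_eq hl'⟩

theorem δ_left_of_length (X : Building cs Δ) {i : I} {c e d : Δ} (h : X.δ e d = cs.simple i)
    (hl : cs.length (cs.simple i * X.δ d c) = cs.length (X.δ d c) + 1) :
    X.δ e c = cs.simple i * X.δ d c :=
  X.δ_of_adj_of_length i d e c h hl

theorem δ_eq_simple_mul_simple (X : Building cs Δ) (hM : M.IsRightAngled) {i j : I} (hij : i ≠ j)
    {c d e : Δ} (hcd : X.δ c d = cs.simple i) (hde : X.δ d e = cs.simple j) :
    X.δ c e = cs.simple i * cs.simple j := by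
  rw [X.δ_left_of_length hcd, hde]
  rw [hde, cs.length_simple]
  rcases cs.length_simple_mul (cs.simple j) i with h | h
  · rw [h, cs.length_simple]
  · rw [cs.length_simple] at h
    have h1 := eq_inv_of_mul_eq_one_left (cs.length_eq_zero_iff.1 (Nat.succ_injective h))
    rw [cs.inv_simple] at h1
    exact absurd (cs.simple_injective_of_isRightAngled hM h1) hij

theorem δ_right (X : Building cs Δ) {i : I} {c d e : Δ} (h : X.δ d e = cs.simple i) :
    X.δ c e = X.δ c d * cs.simple i ∨ X.δ c e = X.δ c d := by
  rcases X.δ_of_adj i d e c (X.δ_simple_symm h) with h1 | h1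
  · left
    rw [X.δ_inv e c, h1, mul_inv_rev, cs.inv_simple, ← X.δ_inv]
  · right
    rw [X.δ_inv e c, h1, ← X.δ_inv]

theorem length_δ_le_of_adj (X : Building cs Δ) {i : I} {c d e : Δ} (h : X.δ e d = cs.simple i) :
    cs.length (X.δ e c) ≤ cs.length (X.δ d c) + 1 := by
  rcases X.δ_of_adj i d e c h with h1 | h1
  · have h2 := cs.length_simple_mul (X.δ d c) i
    rw [h1]
    omega
  · rw [h1]
    omega

/-! ### Panels -/

theorem mem_panel_self (X : Building cs Δ) (i : I) (c : Δ) : c ∈ X.panel i c :=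
  Or.inl (X.δ_self c)

theorem mem_panel_iff (X : Building cs Δ) {i : I} {c d : Δ} :
    d ∈ X.panel i c ↔ d = c ∨ X.δ c d = cs.simple i := by
  rw [panel, Set.mem_ofPred_eq, X.δ_eq_one_iff, eq_comm]

theorem mem_panel_comm (X : Building cs Δ) {i : I} {c d : Δ} :
    d ∈ X.panel i c ↔ c ∈ X.panel i d := by
  rw [mem_panel_iff, mem_panel_iff]
  constructor
  · exact Or.imp Eq.symm X.δ_simple_symm
  · exact Or.imp Eq.symm X.δ_simple_symm

theorem mem_panel_trans (X : Building cs Δ) {i : I} {c d e : Δ} (h : d ∈ X.panel i c)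
    (h' : e ∈ X.panel i d) : e ∈ X.panel i c := by
  rw [mem_panel_iff] at h h' ⊢
  rcases h with rfl | h
  · exact h'
  · rcases h' with rfl | h'
    · exact Or.inr h
    · rcases X.δ_right (c := c) h' with h1 | h1
      · rw [h, cs.simple_mul_simple_self, X.δ_eq_one_iff] at h1
        exact Or.inl h1.symm
      · exact Or.inr (h1.trans h)

theorem panel_eq_of_mem (X : Building cs Δ) {i : I} {c d : Δ} (h : d ∈ X.panel i c) :
    X.panel i d = X.panel i c :=
  Set.ext fun _ => ⟨fun h' => X.mem_panel_trans h h',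
    fun h' => X.mem_panel_trans (X.mem_panel_comm.1 h) h'⟩

theorem isPanel_panel (X : Building cs Δ) (i : I) (c : Δ) : X.IsPanel i (X.panel i c) := ⟨c, rfl⟩

theorem δ_eq_simple_of_mem_panel (X : Building cs Δ) {i : I} {c d : Δ} (h : d ∈ X.panel i c)
    (hne : c ≠ d) : X.δ c d = cs.simple i := by
  rcases X.mem_panel_iff.1 h with rfl | h
  · exact absurd rfl hne
  · exact h

/-! ### Convexity in terms of the Weyl distance -/

theorem HasGallery.exists_isGallery {X : Building cs Δ} {l l' : List I} {c d e : Δ}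
    (h : X.HasGallery l c d) (h' : X.HasGallery l' d e) :
    ∃ γ, X.IsGallery c e γ ∧ γ.length = l.length + l'.length + 1 ∧ d ∈ γ := by
  have hbase : ∀ {l' : List I} {d : Δ}, X.HasGallery l' d e →
      ∃ γ, X.IsGallery d e (d :: γ) ∧ γ.length = l'.length := by
    intro l'
    induction l' with
    | nil =>
      rintro d rfl
      exact ⟨[], ⟨rfl, rfl, List.isChain_singleton _⟩, rfl⟩
    | cons i l' ih =>
      rintro d ⟨f, hf, h1⟩
      obtain ⟨γ, ⟨h2, h3, h4⟩, h5⟩ := ih h1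
      refine ⟨f :: γ, ⟨rfl, ?_, ?_⟩, by simp [h5]⟩
      · rw [List.getLast?_cons_cons, h3]
      · exact List.isChain_cons_cons.2 ⟨⟨i, hf⟩, h4⟩
  have hstep : ∀ {l : List I} {c : Δ}, X.HasGallery l c d →
      ∃ γ, X.IsGallery c e (c :: γ) ∧ γ.length = l.length + l'.length ∧ d ∈ c :: γ := by
    intro l
    induction l with
    | nil =>
      rintro c rfl
      obtain ⟨γ, h1, h2⟩ := hbase h'
      exact ⟨γ, h1, by simp [h2], by simp⟩
    | cons i l ih =>
      rintro c ⟨f, hf, h1⟩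
      obtain ⟨γ, ⟨h2, h3, h4⟩, h5, h6⟩ := ih h1
      refine ⟨f :: γ, ⟨rfl, ?_, ?_⟩, by simp [h5]; omega, List.mem_cons_of_mem _ h6⟩
      · rw [List.getLast?_cons_cons, h3]
      · exact List.isChain_cons_cons.2 ⟨⟨i, hf⟩, h4⟩
  obtain ⟨γ, h1, h2, h3⟩ := hstep h
  exact ⟨c :: γ, h1, by simp [h2], h3⟩

theorem IsGallery.length_δ_lt {X : Building cs Δ} {c d : Δ} {γ : List Δ}
    (h : X.IsGallery c d γ) : cs.length (X.δ c d) < γ.length := by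
  induction γ generalizing c with
  | nil => simp [IsGallery] at h
  | cons e γ ih =>
    obtain ⟨h1, h2, h3⟩ := h
    simp only [List.head?_cons, Option.some.injEq] at h1
    subst h1
    cases γ with
    | nil =>
      simp only [List.getLast?_singleton, Option.some.injEq] at h2
      subst h2
      simp [X.δ_self]
    | cons f γ =>
      rw [List.isChain_cons_cons] at h3
      obtain ⟨⟨i, hi⟩, h3⟩ := h3
      have h4 := ih ⟨rfl, by rwa [List.getLast?_cons_cons] at h2, h3⟩
      have h5 := X.length_δ_le_of_adj (c := d) hi
      rw [List.length_cons]
      omega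

/-- A convex set contains every chamber that lies on a minimal gallery between two of its members,
that is, where the triangle inequality is an equality. -/
theorem IsConvex.mem {X : Building cs Δ} {C : Set Δ} (hC : X.IsConvex C) {c d e : Δ}
    (hc : c ∈ C) (he : e ∈ C)
    (h : cs.length (X.δ c e) = cs.length (X.δ c d) + cs.length (X.δ d e)) : d ∈ C := by
  obtain ⟨l, hl, h1⟩ := cs.exists_isReduced (X.δ c d)
  obtain ⟨l', hl', h2⟩ := cs.exists_isReduced (X.δ d e)
  obtain ⟨γ, h3, h4, h5⟩ :=
    (X.hasGallery_of_δ_eq h1).exists_isGallery (X.hasGallery_of_δ_eq h2)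
  refine hC c hc e he γ ⟨h3, fun γ' hγ' => ?_⟩ d h5
  have h6 := hγ'.length_δ_lt
  rw [h, h1, h2, hl.eq, hl'.eq] at h6
  omega

theorem IsPanelClosed.panel_subset {X : Building cs Δ} {C : Set Δ} (hC : X.IsPanelClosed C)
    {i : I} {c d : Δ} (hc : c ∈ C) (hd : d ∈ C) (h : X.δ c d = cs.simple i) :
    X.panel i c ⊆ C :=
  hC.2 i _ (X.isPanel_panel i c) ⟨c, ⟨X.mem_panel_self i c, hc⟩, d,
    ⟨X.mem_panel_iff.2 (Or.inr h), hd⟩, X.ne_of_δ_eq_simple h⟩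

/-! ### Gates -/

/-- `c` is a gate of `C` for `d`: from `d`, every chamber of `C` can be reached by a minimal
gallery through `c`. Such a `c` is the projection of `d` on `C`. -/
def IsGate (X : Building cs Δ) (C : Set Δ) (d c : Δ) : Prop :=
  c ∈ C ∧ ∀ x ∈ C,
    cs.length (X.δ d c * X.δ c x) = cs.length (X.δ d c) + cs.length (X.δ c x)

namespace IsGate

variable {X : Building cs Δ} {C : Set Δ} {d c : Δ}

theorem δ_eq (h : X.IsGate C d c) {x : Δ} (hx : x ∈ C) : X.δ d x = X.δ d c * X.δ c x :=
  X.δ_eq_mul_of_length (h.2 x hx)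

theorem length_δ (h : X.IsGate C d c) {x : Δ} (hx : x ∈ C) :
    cs.length (X.δ d x) = cs.length (X.δ d c) + cs.length (X.δ c x) := by
  rw [h.δ_eq hx, h.2 x hx]

theorem unique (h : X.IsGate C d c) {c' : Δ} (h' : X.IsGate C d c') : c = c' := by
  have h1 := h.length_δ h'.1
  have h2 := h'.length_δ h.1
  rw [← X.δ_eq_one_iff, ← cs.length_eq_zero_iff]
  omega

theorem of_mem (hd : d ∈ C) : X.IsGate C d d :=
  ⟨hd, fun x _ => by simp [X.δ_self]⟩

/-- A chamber one step closer to the gate has the same gate. -/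
theorem of_adj_of_lt (h : X.IsGate C d c) {i : I} {p : Δ} (hp : X.δ p c = cs.simple i * X.δ d c)
    (hl : cs.length (cs.simple i * X.δ d c) < cs.length (X.δ d c)) : X.IsGate C p c := by
  refine ⟨h.1, fun x hx => ?_⟩
  have h1 := h.2 x hx
  have h2 := cs.length_simple_mul (X.δ d c) i
  have h3 := cs.length_simple_mul (X.δ d c * X.δ c x) i
  have h4 := cs.length_mul_le (cs.simple i * X.δ d c) (X.δ c x)
  rw [hp]
  rw [← mul_assoc] at h3
  omega

end IsGate

/-- Panel-closed sets in right-angled buildings are gated: a chamber of `C` nearest to `d` is a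
gate for `d`. -/
theorem IsPanelClosed.exists_isGate {X : Building cs Δ} (hM : M.IsRightAngled) {C : Set Δ}
    (hC : X.IsPanelClosed C) (hne : C.Nonempty) (d : Δ) : ∃ c, X.IsGate C d c := by
  classical
  obtain ⟨c, hc, hmin⟩ : ∃ c ∈ C, ∀ x ∈ C, cs.length (X.δ d c) ≤ cs.length (X.δ d x) := by
    obtain ⟨c, hc, h⟩ := exists_minimalFor_of_wellFoundedLT (· ∈ C)
      (fun x => cs.length (X.δ d x)) hne
    exact ⟨c, hc, fun x hx => (le_total _ _).elim id (h hx)⟩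
  refine ⟨c, hc, ?_⟩
  suffices H : ∀ m : ℕ, ∀ x ∈ C, cs.length (X.δ c x) = m →
      cs.length (X.δ d c * X.δ c x) = cs.length (X.δ d c) + m from
    fun x hx => H _ x hx rfl
  intro m
  induction m with
  | zero =>
    intro x hx h
    rw [cs.length_eq_zero_iff] at h
    rw [h, mul_one, add_zero]
  | succ m ih =>
    intro x hx hm
    set u := X.δ d c with hu
    have hv : X.δ c x ≠ 1 := by
      intro h
      rw [h, cs.length_one] at hm
      omega
    obtain ⟨j, hj⟩ := cs.exists_rightDescent_of_ne_one hv
    rw [CoxeterSystem.isRightDescent_iff] at hj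
    obtain ⟨y, hy, hyx⟩ := X.exists_δ_eq_and_δ_eq (c := c) (e := x)
      (u := X.δ c x * cs.simple j) (v := cs.simple j) (by simp)
    have hyC : y ∈ C := hC.1.mem hc hx (by rw [hy, hyx, cs.length_simple, hj])
    have hxy : X.δ c x = X.δ c y * cs.simple j := by rw [hy]; simp
    have hym : cs.length (X.δ c y) = m := by rw [hy]; omega
    have ihy := ih y hyC hym
    rw [hxy, ← mul_assoc]
    rcases cs.length_mul_simple (u * X.δ c y) j with h1 | h1
    · omega
    · exfalso
      by_cases hy1 : X.δ c y = 1
      · -- `x` is adjacent to `c`, so the panel of `c` and `x` lies in `C`, but it has a chamber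
        -- nearer to `d`
        have hcy := (X.δ_eq_one_iff c y).1 hy1
        subst hcy
        have hsub := hC.panel_subset hc hx hyx
        rw [hy1, mul_one] at h1
        obtain ⟨z, hz, hzc⟩ := X.exists_δ_eq_and_δ_eq (c := d) (e := c)
          (u := u * cs.simple j) (v := cs.simple j) (by simp [← hu])
        have h2 := hmin z (hsub (X.mem_panel_iff.2 (Or.inr (X.δ_simple_symm hzc))))
        rw [hz] at h2
        omega
      · obtain ⟨k, hk⟩ := cs.exists_rightDescent_of_ne_one hy1
        rw [CoxeterSystem.isRightDescent_iff] at hk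
        set v := X.δ c y * cs.simple k with hv2
        have hyv : X.δ c y = v * cs.simple k := by rw [hv2]; simp
        have hjk : k ≠ j := by
          rintro rfl
          have h2 : v = X.δ c x * cs.simple k * cs.simple k := by rw [hv2, hy]
          rw [cs.simple_mul_simple_cancel_right] at h2
          rw [h2] at hk
          omega
        have hkd : cs.length (u * X.δ c y * cs.simple k) < cs.length (u * X.δ c y) := by
          have h2 := cs.length_mul_le u v
          rw [mul_assoc, ← hv2]
          omega
        obtain ⟨hc', hl⟩ := cs.two_right_descents hM hjk hkd (by omega)
        -- the last two steps of a minimal gallery from `c` to `x` can be interchanged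
        have hxv : X.δ c x = v * cs.simple j * cs.simple k := by
          rw [mul_assoc v, ← hc', ← mul_assoc, ← hyv, hxy]
        obtain ⟨z, hz, hzx⟩ := X.exists_δ_eq_and_δ_eq hxv
        have hzm : cs.length (v * cs.simple j) = m := by
          have h2 := cs.length_mul_simple v j
          have h3 := cs.length_mul_simple (v * cs.simple j) k
          rw [← hxv] at h3
          omega
        have hzC : z ∈ C := hC.1.mem hc hx (by rw [hz, hzx, cs.length_simple]; omega)
        have h2 := ih z hzC (by rw [hz, hzm])
        rw [hz, ← mul_assoc] at h2
        rw [mul_assoc u, ← hv2] at hl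
        omega

/-- Moving away from the gate along an `i`-panel either does not change the gate, or moves the
gate along its `i`-panel, which then lies in `C`. -/
theorem IsGate.adj_cases {X : Building cs Δ} (hM : M.IsRightAngled) {C : Set Δ}
    (hC : X.IsPanelClosed C) {d c : Δ} (h : X.IsGate C d c) {i : I} {e : Δ}
    (he : X.δ e d = cs.simple i)
    (hl : cs.length (cs.simple i * X.δ d c) = cs.length (X.δ d c) + 1) :
    X.IsGate C e c ∨ (cs.simple i * X.δ d c = X.δ d c * cs.simple i ∧ X.panel i c ⊆ C ∧
      ∃ c', X.δ c c' = cs.simple i ∧ X.IsGate C e c' ∧ X.δ e c' = X.δ d c) := by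
  obtain ⟨c', hc'⟩ := hC.exists_isGate hM ⟨c, h.1⟩ e
  by_cases hcc : c' = c
  · exact Or.inl (hcc ▸ hc')
  · right
    have hec := X.δ_left_of_length he hl
    have h1 := hc'.length_δ h.1
    have h2 := h.length_δ hc'.1
    have h3 := X.length_δ_le_of_adj (c := c') (X.δ_simple_symm he)
    have h4 := X.length_δ_comm c c'
    have h5 : cs.length (X.δ c c') ≠ 0 := by
      rw [Ne, cs.length_eq_zero_iff, X.δ_eq_one_iff]
      exact fun h => hcc h.symm
    rw [hec] at h1
    have h6 : cs.length (X.δ c c') = 1 := by omega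
    obtain ⟨j, hj⟩ := cs.length_eq_one_iff.1 h6
    have h7 := hc'.δ_eq h.1
    rw [hec, X.δ_simple_symm hj] at h7
    have h8 : X.δ d c' = cs.simple i * X.δ e c' := by
      rcases X.δ_of_adj i e d c' (X.δ_simple_symm he) with h8 | h8
      · exact h8
      · rw [h8] at h2
        omega
    rw [h8] at h2
    obtain ⟨rfl, h9⟩ := cs.eq_of_simple_mul_eq_mul_simple hM h7 hl (by omega) (by omega)
    rw [← h9] at h7
    exact ⟨h7, hC.panel_subset h.1 hc'.1 hj, c', hj, hc', h9.symm⟩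

/-- The `i`-panel of `d` is *transverse* to `C`, where `c` is the gate of `C` for `d`: the
`i`-panel of `c` lies in `C`, and `s i` commutes with `δ d c` and increases its length. As
`IsTransverse.parallel` shows, the two panels are then parallel. -/
def IsTransverse (X : Building cs Δ) (C : Set Δ) (i : I) (d c : Δ) : Prop :=
  cs.simple i * X.δ d c = X.δ d c * cs.simple i ∧
    cs.length (cs.simple i * X.δ d c) = cs.length (X.δ d c) + 1 ∧ X.panel i c ⊆ C

/-- The chambers of a transverse panel are all at the same Weyl distance from their gates, which are
pairwise `i`-adjacent. -/
theorem IsTransverse.exists_gate_of_adj {X : Building cs Δ} (hM : M.IsRightAngled) {C : Set Δ}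
    (hC : X.IsPanelClosed C) {d c : Δ} (h : X.IsGate C d c) {i : I}
    (ht : X.IsTransverse C i d c) {e : Δ} (he : X.δ e d = cs.simple i) :
    ∃ c', X.δ c c' = cs.simple i ∧ X.IsGate C e c' ∧ X.δ e c' = X.δ d c := by
  obtain ⟨h1, hl, hsub⟩ := ht
  rcases h.adj_cases hM hC he hl with h2 | h2
  · exfalso
    obtain ⟨z, hz, hzc⟩ := X.exists_δ_eq_and_δ_eq ((X.δ_left_of_length he hl).trans h1)
    have h3 := h2.length_δ (hsub (X.mem_panel_iff.2 (Or.inr (X.δ_simple_symm hzc))))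
    rw [hz, X.δ_simple_symm hzc, X.δ_left_of_length he hl, cs.length_simple] at h3
    omega
  · exact h2.2.2

theorem IsTransverse.parallel {X : Building cs Δ} (hM : M.IsRightAngled) {C : Set Δ}
    (hC : X.IsPanelClosed C) {d c : Δ} (h : X.IsGate C d c) {i : I}
    (ht : X.IsTransverse C i d c) : X.Parallel (X.panel i d) (X.panel i c) := by
  -- every chamber of one panel has a partner in the other one at Weyl distance `u`
  set u := X.δ d c with hu
  have hlu : cs.length (cs.simple i * u) = cs.length u + 1 := ht.2.1
  have hul : cs.length (u * cs.simple i) = cs.length u + 1 := by rw [← ht.1, hlu]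
  have hfar : ∀ {x y z : Δ}, X.δ x y = u → z ∈ X.panel i y → z ≠ y →
      cs.length (X.δ x y) < cs.length (X.δ x z) := by
    intro x y z hxy hz hne
    have hyz := X.δ_eq_simple_of_mem_panel hz hne.symm
    rw [X.δ_eq_mul_of_length (d := y) (e := z) (by rw [hxy, hyz, hul, cs.length_simple]), hxy, hyz]
    omega
  have hfar' : ∀ {x y z : Δ}, X.δ y x = u → z ∈ X.panel i y → z ≠ y →
      cs.length (X.δ x y) < cs.length (X.δ x z) := by
    intro x y z hxy hz hne
    have hyz := X.δ_simple_symm (X.δ_eq_simple_of_mem_panel hz hne.symm)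
    rw [X.length_δ_comm y x, X.length_δ_comm z x, X.δ_left_of_length hyz (by rw [hxy, hlu]),
      hxy, hlu]
    omega
  have hpart : ∀ e ∈ X.panel i d, ∃ c' ∈ X.panel i c, X.δ e c' = u := by
    intro e he
    rcases X.mem_panel_iff.1 he with rfl | he
    · exact ⟨c, X.mem_panel_self i c, rfl⟩
    · obtain ⟨c', h1, -, h2⟩ := ht.exists_gate_of_adj hM hC h (X.δ_simple_symm he)
      exact ⟨c', X.mem_panel_iff.2 (Or.inr h1), h2⟩
  have hpart' : ∀ x ∈ X.panel i c, ∃ e ∈ X.panel i d, X.δ e x = u := by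
    intro x hx
    rcases X.mem_panel_iff.1 hx with rfl | hx
    · exact ⟨d, X.mem_panel_self i d, rfl⟩
    · have h1 : X.δ d x = cs.simple i * u := by
        rw [ht.1, X.δ_eq_mul_of_length (d := c) (by rw [← hu, hx, hul, cs.length_simple]), hx]
      obtain ⟨e, h2, h3⟩ := X.exists_δ_eq_and_δ_eq h1
      exact ⟨e, X.mem_panel_iff.2 (Or.inr h2), h3⟩
  constructor
  · refine Set.Subset.antisymm (fun e he => ?_) (fun e he => ?_)
    · obtain ⟨x, -, hx⟩ := he
      exact hx.1
    · obtain ⟨x, hx, h1⟩ := hpart e he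
      refine ⟨x, hx, he, fun z hz hne => hfar' h1 ?_ hne⟩
      rw [X.panel_eq_of_mem he]
      exact hz
  · refine Set.Subset.antisymm (fun e he => ?_) (fun x hx => ?_)
    · obtain ⟨x, -, hx⟩ := he
      exact hx.1
    · obtain ⟨e, he, h1⟩ := hpart' x hx
      refine ⟨e, he, hx, fun z hz hne => hfar h1 ?_ hne⟩
      rw [X.panel_eq_of_mem hx]
      exact hz

end Building

/-! ### Recursion along a locally confluent relation -/

/-- Recursion on a rank function `D` along labelled steps `R i p d` that lower `D`: the value at
`d` may be computed from any `p` with `R i p d`, provided that any two different steps into `d`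
can be completed to a square around which the recursion rule commutes. -/
theorem exists_recursion_of_confluent {ι α β : Type*} (D : α → ℕ) (R : ι → α → α → Prop)
    (hR : ∀ i p d, R i p d → D p < D d) (step : ι → α → α → β → β)
    (hconf : ∀ i j p q d, R i p d → R j q d → (i = j ∧ p = q) ∨
      ∃ r, R j r p ∧ R i r q ∧ ∀ y, step i p d (step j r p y) = step j q d (step i r q y))
    (g : α → β) :
    ∃ h : α → β, (∀ d, (∀ i p, ¬ R i p d) → h d = g d) ∧
      ∀ i p d, R i p d → h d = step i p d (h p) := by
  classical
  let F : (d : α) → ((p : α) → D p < D d → β) → β := fun d rec =>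
    if hd : ∃ x : ι × α, R x.1 x.2 d then
      step hd.choose.1 hd.choose.2 d (rec hd.choose.2 (hR _ _ _ hd.choose_spec))
    else g d
  let h : α → β := (measure D).wf.fix F
  have hF : ∀ d, h d = F d fun p _ => h p := fun d => (measure D).wf.fix_eq F d
  refine ⟨h, fun d hd => ?_, ?_⟩
  · rw [hF]
    exact dif_neg fun ⟨x, hx⟩ => hd _ _ hx
  · suffices H : ∀ (n : ℕ) (i : ι) (p d : α), D d = n → R i p d → h d = step i p d (h p) from
      fun i p d => H _ i p d rfl
    intro n
    induction n using Nat.strong_induction_on with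
    | _ n ih =>
      intro i p d hn hp
      have hex : ∃ x : ι × α, R x.1 x.2 d := ⟨(i, p), hp⟩
      have h1 : h d = step hex.choose.1 hex.choose.2 d (h hex.choose.2) := by
        rw [hF]
        exact dif_pos hex
      rw [h1]
      rcases hconf i _ p _ d hp hex.choose_spec with ⟨h2, h3⟩ | ⟨r, h2, h3, h4⟩
      · rw [← h2, ← h3]
      · rw [ih _ (by have := hR _ _ _ hex.choose_spec; omega) _ _ _ rfl h3,
          ih _ (by have := hR _ _ _ hp; omega) _ _ _ rfl h2, h4]

namespace Building

variable {I W Δ : Type*} [Group W] {M : CoxeterMatrix I} {cs : CoxeterSystem M W}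

/-! ### Chambers one step closer to a gated set -/

/-- `p` is `i`-adjacent to `d` and one step closer than `d` to a gated set, where `π` is the
projection on that set. -/
def IsLower (X : Building cs Δ) (π : Δ → Δ) (i : I) (p d : Δ) : Prop :=
  X.δ p d = cs.simple i ∧ cs.length (X.δ p (π p)) + 1 = cs.length (X.δ d (π d))

section Lower

variable {X : Building cs Δ} {C : Set Δ} {π : Δ → Δ}

theorem isLower_of_δ_eq (hπ : ∀ d, X.IsGate C d (π d)) {i : I} {p d : Δ}
    (h : X.δ p d = cs.simple i) (hp : X.δ p (π d) = cs.simple i * X.δ d (π d))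
    (hl : cs.length (cs.simple i * X.δ d (π d)) < cs.length (X.δ d (π d))) :
    X.IsLower π i p d := by
  have h1 := (hπ p).unique ((hπ d).of_adj_of_lt hp hl)
  refine ⟨h, ?_⟩
  have h2 := cs.length_simple_mul (X.δ d (π d)) i
  rw [h1, hp]
  omega

/-- A chamber one step closer to `C` has the same projection on `C`. -/
theorem IsLower.spec (hM : M.IsRightAngled) (hC : X.IsPanelClosed C)
    (hπ : ∀ d, X.IsGate C d (π d)) {i : I} {p d : Δ} (h : X.IsLower π i p d) :
    π p = π d ∧ X.δ p (π d) = cs.simple i * X.δ d (π d) ∧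
      cs.length (cs.simple i * X.δ d (π d)) < cs.length (X.δ d (π d)) := by
  obtain ⟨h1, h2⟩ := h
  rcases cs.length_simple_mul (X.δ p (π p)) i with hl | hl
  · rcases (hπ p).adj_cases hM hC (X.δ_simple_symm h1) hl with h3 | ⟨-, -, c', -, h3, h4⟩
    · have h5 := h3.unique (hπ d)
      have h6 := X.δ_left_of_length (X.δ_simple_symm h1) hl
      rw [h5] at h6
      refine ⟨h5, ?_, ?_⟩
      · rw [h6, cs.simple_mul_simple_cancel_left]
      · rw [h6, cs.simple_mul_simple_cancel_left, ← h6, ← h2, h5]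
        omega
    · rw [h3.unique (hπ d)] at h4
      rw [h4] at h2
      omega
  · exfalso
    have h3 := (hπ d).length_δ (hπ p).1
    rcases X.δ_of_adj i p d (π p) (X.δ_simple_symm h1) with h4 | h4 <;> rw [h4] at h3 <;> omega

theorem exists_isLower (hπ : ∀ d, X.IsGate C d (π d)) {i : I} {d : Δ}
    (hl : cs.length (cs.simple i * X.δ d (π d)) < cs.length (X.δ d (π d))) :
    ∃ p, X.IsLower π i p d := by
  obtain ⟨p, h1, h2⟩ := X.exists_adj i d (π d)
  exact ⟨p, isLower_of_δ_eq hπ h1 h2 hl⟩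

/-- Two different steps towards a gated set have commuting types, and can be completed to a
square. -/
theorem IsLower.diamond (hM : M.IsRightAngled) (hC : X.IsPanelClosed C)
    (hπ : ∀ d, X.IsGate C d (π d)) {i j : I} {p q d : Δ} (hp : X.IsLower π i p d)
    (hq : X.IsLower π j q d) : (i = j ∧ p = q) ∨
      (i ≠ j ∧ cs.simple i * cs.simple j = cs.simple j * cs.simple i ∧
        ∃ r, X.IsLower π j r p ∧ X.IsLower π i r q) := by
  have huniq : ∀ {j : I} {q q' : Δ}, X.IsLower π j q d → X.IsLower π j q' d → q = q' := by
    intro j q q' hq hq'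
    by_contra hne
    obtain ⟨-, h1, hl⟩ := hq.spec hM hC hπ
    obtain ⟨-, h2, -⟩ := hq'.spec hM hC hπ
    have h3 : X.δ q q' = cs.simple j :=
      X.δ_eq_simple_of_mem_panel (X.mem_panel_trans (X.mem_panel_iff.2 (Or.inr hq.1))
        (X.mem_panel_iff.2 (Or.inr (X.δ_simple_symm hq'.1)))) hne
    have hl' := cs.length_simple_mul (X.δ d (π d)) j
    have h4 := X.δ_left_of_length (c := π d) h3
      (by rw [h2, cs.simple_mul_simple_cancel_left]; omega)
    rw [h1, h2, cs.simple_mul_simple_cancel_left] at h4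
    rw [h4] at hl
    omega
  by_cases hij : i = j
  · subst hij
    exact Or.inl ⟨rfl, huniq hp hq⟩
  · right
    obtain ⟨hp1, hp2, hp3⟩ := hp.spec hM hC hπ
    obtain ⟨hq1, hq2, hq3⟩ := hq.spec hM hC hπ
    obtain ⟨hc, hl⟩ := cs.two_left_descents hM hij hp3 hq3
    have hpl := cs.length_simple_mul (X.δ d (π d)) i
    have hql := cs.length_simple_mul (X.δ d (π d)) j
    obtain ⟨r, hr1, hr2⟩ := X.exists_adj j p (π d)
    have hji : cs.simple j * (cs.simple i * X.δ d (π d)) =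
        cs.simple i * (cs.simple j * X.δ d (π d)) := by
      rw [← mul_assoc, ← hc, mul_assoc]
    have hrp : X.IsLower π j r p := by
      refine isLower_of_δ_eq hπ hr1 ?_ ?_
      · rw [hp1, hr2]
      · rw [hp1, hp2, hji]
        omega
    have hrd : X.δ r d = cs.simple i * cs.simple j := by
      rw [hc, X.δ_eq_simple_mul_simple hM (Ne.symm hij) hr1 hp.1]
    obtain ⟨q', h1, h2⟩ := X.exists_δ_eq_and_δ_eq hrd
    have hq' : X.δ q' (π d) = cs.simple j * X.δ d (π d) := by
      rw [X.δ_left_of_length (X.δ_simple_symm h1), hr2, hp2, hji,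
        cs.simple_mul_simple_cancel_left]
      rw [hr2, hp2, hji, cs.simple_mul_simple_cancel_left]
      omega
    have hqq : q' = q := huniq (isLower_of_δ_eq hπ h2 hq' hq3) hq
    subst hqq
    refine ⟨hij, hc, r, hrp, isLower_of_δ_eq hπ h1 ?_ ?_⟩
    · rw [hq1, hr2, hp2, hq2, hji]
    · rw [hq1, hq2]
      omega

theorem exists_isLower_of_notMem (hπ : ∀ d, X.IsGate C d (π d)) {d : Δ} (hd : d ∉ C) :
    ∃ i p, X.IsLower π i p d := by
  have h1 : X.δ d (π d) ≠ 1 := by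
    intro h
    rw [X.δ_eq_one_iff] at h
    exact hd (h ▸ (hπ d).1)
  obtain ⟨i, hi⟩ := cs.exists_leftDescent_of_ne_one h1
  exact ⟨i, exists_isLower hπ hi⟩

theorem not_isLower_of_mem (hπ : ∀ d, X.IsGate C d (π d)) {d : Δ} (hd : d ∈ C) (i : I) (p : Δ) :
    ¬ X.IsLower π i p d := by
  intro h
  have h1 := h.2
  rw [(hπ d).unique (IsGate.of_mem hd), X.δ_self, cs.length_one] at h1
  omega

/-- A panel that is not transverse to `C` has a unique chamber `p` closest to `C`. -/
theorem exists_isLower_of_not_isTransverse (hM : M.IsRightAngled) (hC : X.IsPanelClosed C)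
    (hπ : ∀ d, X.IsGate C d (π d)) {i : I} {d : Δ} (hd : ¬ X.IsTransverse C i d (π d)) :
    ∃ p ∈ X.panel i d, ∀ e ∈ X.panel i d, e ≠ p → X.IsLower π i p e := by
  have key : ∀ p, cs.length (cs.simple i * X.δ p (π p)) = cs.length (X.δ p (π p)) + 1 →
      ¬ X.IsTransverse C i p (π p) → ∀ e ∈ X.panel i p, e ≠ p → X.IsLower π i p e := by
    intro p hl hp e he hne
    have h1 := X.δ_eq_simple_of_mem_panel he hne.symm
    rcases (hπ p).adj_cases hM hC (X.δ_simple_symm h1) hl with h2 | ⟨h2, h3, -⟩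
    · have h3 := h2.unique (hπ e)
      have h4 := X.δ_left_of_length (X.δ_simple_symm h1) hl
      refine ⟨h1, ?_⟩
      rw [← h3, h4, hl]
    · exact absurd ⟨h2, hl, h3⟩ hp
  rcases cs.length_simple_mul (X.δ d (π d)) i with hl | hl
  · exact ⟨d, X.mem_panel_self i d, key d hl hd⟩
  · obtain ⟨p, hp⟩ := exists_isLower hπ (i := i) (d := d) (by omega)
    have hpd : p ∈ X.panel i d := X.mem_panel_iff.2 (Or.inr (X.δ_simple_symm hp.1))
    obtain ⟨h1, h2, -⟩ := hp.spec hM hC hπ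
    refine ⟨p, hpd, ?_⟩
    rw [← X.panel_eq_of_mem hpd]
    refine key p ?_ fun ht => ?_
    · rw [h1, h2, cs.simple_mul_simple_cancel_left]
      omega
    · -- crossing a transverse panel would change the gate
      obtain ⟨c', h3, h4, -⟩ := ht.exists_gate_of_adj hM hC (hπ p) (X.δ_simple_symm hp.1)
      rw [h4.unique (hπ d), h1, X.δ_self] at h3
      exact cs.simple_ne_one i h3.symm

/-- A panel transverse to `C` that does not lie in `C` is, along a commuting direction `j`, next
to a transverse panel closer to `C`. -/
theorem IsTransverse.exists_lower (hM : M.IsRightAngled) (hC : X.IsPanelClosed C)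
    (hπ : ∀ d, X.IsGate C d (π d)) {i : I} {d : Δ} (ht : X.IsTransverse C i d (π d))
    (hd : d ∉ C) :
    ∃ j q, j ≠ i ∧ cs.simple i * cs.simple j = cs.simple j * cs.simple i ∧
      X.IsLower π j q d ∧ X.IsTransverse C i q (π q) ∧
      ∀ e ∈ X.panel i d, ∃ e' ∈ X.panel i q, X.IsLower π j e' e := by
  obtain ⟨j, q, hq⟩ := exists_isLower_of_notMem hπ hd
  obtain ⟨hq1, hq2, hq3⟩ := hq.spec hM hC hπ
  obtain ⟨h1, h2, h3⟩ := ht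
  have hji : i ≠ j := by
    rintro rfl
    omega
  have hl1 : cs.length (cs.simple j * (cs.simple i * X.δ d (π d))) <
      cs.length (cs.simple i * X.δ d (π d)) := by
    have h4 := cs.length_mul_le (cs.simple j * X.δ d (π d)) (cs.simple i)
    rw [cs.length_simple, mul_assoc, ← h1] at h4
    omega
  obtain ⟨hc, hl⟩ := cs.two_left_descents hM (w := cs.simple i * X.δ d (π d)) hji
    (by rw [cs.simple_mul_simple_cancel_left]; omega) hl1
  have hij : cs.simple i * (cs.simple j * X.δ d (π d)) =
      cs.simple j * (cs.simple i * X.δ d (π d)) := by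
    rw [← mul_assoc, hc, mul_assoc]
  have hql := cs.length_simple_mul (X.δ d (π d)) j
  have hqt : X.IsTransverse C i q (π q) := by
    refine ⟨?_, ?_, ?_⟩
    · rw [hq1, hq2, hij, h1, mul_assoc]
    · rw [hq1, hq2, hij]
      have h5 := cs.length_simple_mul (cs.simple i * X.δ d (π d)) j
      omega
    · rw [hq1]
      exact h3
  refine ⟨j, q, hji.symm, hc, hq, hqt, fun e he => ?_⟩
  rcases X.mem_panel_iff.1 he with rfl | he
  · exact ⟨q, X.mem_panel_self i q, hq⟩
  · have hqe : X.δ q e = cs.simple i * cs.simple j := by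
      rw [hc, X.δ_eq_simple_mul_simple hM hji.symm hq.1 he]
    obtain ⟨z, hz1, hz2⟩ := X.exists_δ_eq_and_δ_eq hqe
    refine ⟨z, X.mem_panel_iff.2 (Or.inr hz1), hz2, ?_⟩
    obtain ⟨c', -, h5, h6⟩ := hqt.exists_gate_of_adj hM hC (hπ q) (X.δ_simple_symm hz1)
    obtain ⟨c'', -, h7, h8⟩ := IsTransverse.exists_gate_of_adj hM hC (hπ d) ⟨h1, h2, h3⟩
      (X.δ_simple_symm he)
    rw [← h5.unique (hπ z), ← h7.unique (hπ e), h6, h8, hq.2]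

end Lower

namespace LegalColoring

variable {X : Building cs Δ} {Ω : I → Type*}

/-! ### Moving along panels by colors -/

/-- The chamber with `i`-color `ω` in the `i`-panel of `d`. -/
noncomputable def recolor (col : X.LegalColoring Ω) (i : I) (d : Δ) (ω : Ω i) : Δ :=
  ((col.bijOn i _ (X.isPanel_panel i d)).surjOn (Set.mem_univ ω)).choose

theorem recolor_mem (col : X.LegalColoring Ω) (i : I) (d : Δ) (ω : Ω i) :
    col.recolor i d ω ∈ X.panel i d :=
  ((col.bijOn i _ (X.isPanel_panel i d)).surjOn (Set.mem_univ ω)).choose_spec.1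

@[simp]
theorem color_recolor (col : X.LegalColoring Ω) (i : I) (d : Δ) (ω : Ω i) :
    col.color i (col.recolor i d ω) = ω :=
  ((col.bijOn i _ (X.isPanel_panel i d)).surjOn (Set.mem_univ ω)).choose_spec.2

theorem eq_of_color_eq (col : X.LegalColoring Ω) {i : I} {d e : Δ} (h : e ∈ X.panel i d)
    (h' : col.color i e = col.color i d) : e = d :=
  (col.bijOn i _ (X.isPanel_panel i d)).injOn h (X.mem_panel_self i d) h'

theorem color_eq_of_mem_panel (col : X.LegalColoring Ω) {i j : I} (hij : j ≠ i) {d e : Δ}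
    (h : e ∈ X.panel i d) : col.color j e = col.color j d :=
  col.constant i j hij _ (X.isPanel_panel i d) e h d (X.mem_panel_self i d)

theorem color_recolor_of_ne (col : X.LegalColoring Ω) {i j : I} (hij : j ≠ i) (d : Δ) (ω : Ω i) :
    col.color j (col.recolor i d ω) = col.color j d :=
  col.color_eq_of_mem_panel hij (col.recolor_mem i d ω)

theorem recolor_color_of_mem (col : X.LegalColoring Ω) {i : I} {d e : Δ}
    (h : e ∈ X.panel i d) : col.recolor i d (col.color i e) = e := by
  refine col.eq_of_color_eq ?_ (col.color_recolor i d _)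
  rw [X.panel_eq_of_mem h]
  exact col.recolor_mem i d _

theorem recolor_eq_of_mem (col : X.LegalColoring Ω) {i : I} {d e : Δ} (h : e ∈ X.panel i d)
    (ω : Ω i) : col.recolor i e ω = col.recolor i d ω := by
  have h1 : col.recolor i e ω ∈ X.panel i d := X.mem_panel_trans h (col.recolor_mem i e ω)
  rw [← col.recolor_color_of_mem h1, col.color_recolor]

/-- In a residue of type `{i, j}` with commuting `i` and `j`, the `i`- and `j`-colors can be
changed independently. -/
theorem recolor_recolor_comm (col : X.LegalColoring Ω) (hM : M.IsRightAngled) {i j : I}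
    (hij : i ≠ j) (hc : cs.simple i * cs.simple j = cs.simple j * cs.simple i) (d : Δ) (α : Ω i)
    (β : Ω j) :
    col.recolor i (col.recolor j d β) α = col.recolor j (col.recolor i d α) β := by
  set y := col.recolor j d β with hy
  set z := col.recolor i y α with hz
  have hyd := col.recolor_mem j d β
  have hzy := col.recolor_mem i y α
  rw [← hy] at hyd
  rw [← hz] at hzy
  have hzα : col.color i z = α := by simp [hz]
  have hzβ : col.color j z = β := by
    rw [col.color_eq_of_mem_panel hij.symm hzy]
    simp [hy]
  -- it suffices to find a chamber `x` in the `i`-panel of `d` and the `j`-panel of `z`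
  suffices H : ∃ x ∈ X.panel i d, z ∈ X.panel j x by
    obtain ⟨x, hx, hzx⟩ := H
    rw [← col.recolor_color_of_mem hzx, hzβ, ← col.recolor_color_of_mem hx,
      ← col.color_eq_of_mem_panel hij hzx, hzα]
  rcases X.mem_panel_iff.1 hyd with h | h1
  · rw [h] at hzy
    exact ⟨z, hzy, X.mem_panel_self j z⟩
  · rcases X.mem_panel_iff.1 hzy with h | h2
    · rw [h]
      exact ⟨d, X.mem_panel_self i d, hyd⟩
    · have h3 : X.δ d z = cs.simple i * cs.simple j := by
        rw [hc, X.δ_eq_simple_mul_simple hM hij.symm h1 h2]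
      obtain ⟨x, hx, hxz⟩ := X.exists_δ_eq_and_δ_eq h3
      exact ⟨x, X.mem_panel_iff.2 (Or.inr hx), X.mem_panel_iff.2 (Or.inr hxz)⟩

/-! ### Automorphisms from local permutations -/

/-- A map that acts on each `i`-panel through a permutation of the `i`-colors is an
automorphism. -/
theorem mem_aut_of_local (col : X.LegalColoring Ω) (h : Δ → Δ)
    (hloc : ∀ (i : I) (d : Δ), ∃ σ : Equiv.Perm (Ω i), ∀ e ∈ X.panel i d,
      h e = col.recolor i (h d) (σ (col.color i e))) :
    ∃ a : X.aut, ∀ d, a.1 d = h d := by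
  have hadj : ∀ (i : I) (d e : Δ), X.δ d e = cs.simple i → X.δ (h d) (h e) = cs.simple i := by
    intro i d e hde
    obtain ⟨σ, hσ⟩ := hloc i d
    have he : e ∈ X.panel i d := X.mem_panel_iff.2 (Or.inr hde)
    refine X.δ_eq_simple_of_mem_panel (hσ e he ▸ col.recolor_mem i (h d) _) fun heq => ?_
    have h1 := congrArg (col.color i) heq
    rw [hσ d (X.mem_panel_self i d), hσ e he, col.color_recolor, col.color_recolor] at h1
    exact X.ne_of_δ_eq_simple hde
      (col.eq_of_color_eq he (σ.injective h1).symm).symm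
  have hgal : ∀ (l : List I) (d e : Δ), X.HasGallery l d e → X.HasGallery l (h d) (h e) := by
    intro l
    induction l with
    | nil =>
      rintro d e rfl
      rfl
    | cons i l ih =>
      rintro d e ⟨f, hf, h1⟩
      exact ⟨h f, hadj i d f hf, ih f e h1⟩
  have hδ : ∀ d e, X.δ (h d) (h e) = X.δ d e := by
    intro d e
    obtain ⟨l, hl, h1⟩ := cs.exists_isReduced (X.δ d e)
    rw [(hgal l d e (X.hasGallery_of_δ_eq h1)).δ_eq hl, h1]
  have hinj : Function.Injective h := by
    intro d e hde
    rw [← X.δ_eq_one_iff, ← hδ, hde, X.δ_self]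
  have hsurj : Function.Surjective h := by
    have key : ∀ (l : List I) (d y : Δ), X.HasGallery l (h d) y → ∃ e, h e = y := by
      intro l
      induction l with
      | nil =>
        rintro d y rfl
        exact ⟨d, rfl⟩
      | cons i l ih =>
        rintro d y ⟨f, hf, h1⟩
        obtain ⟨σ, hσ⟩ := hloc i d
        have h2 : h (col.recolor i d (σ.symm (col.color i f))) = f := by
          rw [hσ _ (col.recolor_mem i d _), col.color_recolor, Equiv.apply_symm_apply]
          exact col.recolor_color_of_mem (X.mem_panel_iff.2 (Or.inr hf))
        rw [← h2] at h1
        exact ih _ y h1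
    intro y
    obtain ⟨d⟩ := X.nonempty
    obtain ⟨l, -, h1⟩ := cs.exists_isReduced (X.δ (h d) y)
    exact key l d y (X.hasGallery_of_δ_eq h1)
  exact ⟨⟨Equiv.ofBijective h ⟨hinj, hsurj⟩, hδ⟩, fun d => rfl⟩

theorem localAction_color (col : X.LegalColoring Ω) (a : X.aut) {i : I} {P : Set Δ}
    (hP : X.IsPanel i P) {e : Δ} (he : e ∈ P) :
    col.localAction a hP (col.color i e) = col.color i (a.1 e) := by
  have h1 : (col.panelEquiv hP).symm (col.color i e) = ⟨e, he⟩ := by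
    rw [Equiv.symm_apply_eq]
    rfl
  simp only [localAction, Equiv.trans_apply, h1]
  rfl

theorem localAction_eq (col : X.LegalColoring Ω) (a : X.aut) {i : I} {d : Δ}
    (hP : X.IsPanel i (X.panel i d)) {σ : Equiv.Perm (Ω i)}
    (hσ : ∀ e ∈ X.panel i d, a.1 e = col.recolor i (a.1 d) (σ (col.color i e))) :
    col.localAction a hP = σ := by
  ext ω
  have h1 := col.localAction_color a hP (col.recolor_mem i d ω)
  rw [hσ _ (col.recolor_mem i d ω)] at h1
  simpa using h1

theorem apply_eq_recolor (col : X.LegalColoring Ω) (a : X.aut) {i : I} {d e : Δ}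
    (he : e ∈ X.panel i d) :
    a.1 e = col.recolor i (a.1 d) (col.localAction a (X.isPanel_panel i d) (col.color i e)) := by
  rw [col.localAction_color a _ he]
  refine (col.recolor_color_of_mem ?_).symm
  rw [panel, Set.mem_ofPred_eq, a.2]
  exact he

theorem Harmonious.refl (col : X.LegalColoring Ω) (F : (i : I) → Subgroup (Equiv.Perm (Ω i)))
    (c : Δ) : col.Harmonious F c c :=
  fun _ => MulAction.mem_orbit_self _

end LegalColoring

end Building

/-! ### Extension of automorphisms from panel-closed sets -/

theorem mainTheorem4 {I W Δ : Type*} [Group W] {M : CoxeterMatrix I} (hM : M.IsRightAngled)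
    (cs : CoxeterSystem M W) (X : Building cs Δ) {Ω : I → Type*} (col : X.LegalColoring Ω)
    (F : (i : I) → Subgroup (Equiv.Perm (Ω i)))
    (C : Set Δ) (hC : X.IsPanelClosed C)
    (g : X.aut) (hg : ∀ c ∈ C, col.Harmonious F c (g.1 c)) :
    ∃ h : X.aut,
      (∀ c ∈ C, h.1 c = g.1 c) ∧
      (∀ (i : I) (P : Set Δ) (hP : X.IsPanel i P),
        (∃ (j : I) (Q : Set Δ), X.IsPanel j Q ∧ Q ⊆ C ∧ X.Parallel P Q) ∨
          col.localAction h hP ∈ F i) ∧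
      (∀ c : Δ, col.Harmonious F c (h.1 c)) := by
  classical
  rcases C.eq_empty_or_nonempty with rfl | hne
  · refine ⟨1, by simp, ?_, fun c => Building.LegalColoring.Harmonious.refl col F c⟩
    intro i P hP
    obtain ⟨d, rfl⟩ := id hP
    right
    rw [col.localAction_eq 1 hP (σ := 1) fun e he => (col.recolor_color_of_mem he).symm]
    exact one_mem _
  choose π hπ using fun d => hC.exists_isGate hM hne d
  -- the correction `f i a b` in `F i` moves `a` to `b` whenever this is possible
  have hf : ∀ (i : I) (a b : Ω i), ∃ σ ∈ F i, b ∈ MulAction.orbit (F i) a → σ a = b := by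
    intro i a b
    by_cases h : b ∈ MulAction.orbit (F i) a
    · obtain ⟨σ, hσ⟩ := h
      exact ⟨σ.1, σ.2, fun _ => hσ⟩
    · exact ⟨1, one_mem _, fun h' => absurd h' h⟩
  choose f hfF hfab using hf
  obtain ⟨h, hbase, hstep⟩ := exists_recursion_of_confluent
    (fun d => cs.length (X.δ d (π d))) (X.IsLower π) (fun i p d hp => by have := hp.2; omega)
    (fun i p d y => col.recolor i y (f i (col.color i p) (col.color i y) (col.color i d)))
    (by
      intro i j p q d hp hq
      rcases hp.diamond hM hC hπ hq with h1 | ⟨hij, hc, r, hrp, hrq⟩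
      · exact Or.inl h1
      · refine Or.inr ⟨r, hrp, hrq, fun y => ?_⟩
        have adj : ∀ {k : I} {x z : Δ}, X.IsLower π k x z → z ∈ X.panel k x :=
          fun hx => X.mem_panel_iff.2 (Or.inr hx.1)
        rw [col.color_recolor_of_ne hij, col.color_recolor_of_ne hij.symm,
          col.color_eq_of_mem_panel hij (adj hrp), col.color_eq_of_mem_panel hij.symm (adj hrq),
          ← col.color_eq_of_mem_panel hij (adj hq),
          ← col.color_eq_of_mem_panel hij.symm (adj hp)]
        exact col.recolor_recolor_comm hM hij hc _ _ _)
    (fun d => g.1 d)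
  have hC' : ∀ c ∈ C, h c = g.1 c := fun c hc =>
    hbase c fun i p => Building.not_isLower_of_mem hπ hc i p
  -- the two cases `d ∈ C` and `d ∉ C` use the hypothesis on `g` and `f i a b ∈ F i`
  have hharm : ∀ (n : ℕ) (d : Δ), cs.length (X.δ d (π d)) = n → col.Harmonious F d (h d) := by
    intro n
    induction n using Nat.strong_induction_on with
    | _ n ih =>
      intro d hn
      by_cases hd : d ∈ C
      · rw [hC' d hd]
        exact hg d hd
      · obtain ⟨i, p, hp⟩ := Building.exists_isLower_of_notMem hπ hd
        have h1 := ih _ (by have := hp.2; omega) p rfl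
        have hpd : d ∈ X.panel i p := X.mem_panel_iff.2 (Or.inr hp.1)
        rw [hstep i p d hp]
        intro k
        by_cases hk : k = i
        · subst hk
          rw [col.color_recolor]
          exact ⟨⟨_, hfF k _ _⟩, rfl⟩
        · rw [col.color_recolor_of_ne hk, col.color_eq_of_mem_panel hk hpd]
          exact h1 k
  -- on a transverse panel `h` acts through the local action of `g` at a parallel panel in `C`
  have htrans : ∀ (n : ℕ) (i : I) (d : Δ), cs.length (X.δ d (π d)) = n →
      X.IsTransverse C i d (π d) → ∃ σ : Equiv.Perm (Ω i), ∀ e ∈ X.panel i d,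
        h e = col.recolor i (h d) (σ (col.color i e)) := by
    intro n
    induction n using Nat.strong_induction_on with
    | _ n ih =>
      intro i d hn ht
      by_cases hd : d ∈ C
      · have hsub : X.panel i d ⊆ C := by
          have := ht.2.2
          rwa [(hπ d).unique (Building.IsGate.of_mem hd)] at this
        refine ⟨col.localAction g (X.isPanel_panel i d), fun e he => ?_⟩
        rw [hC' e (hsub he), hC' d hd]
        exact col.apply_eq_recolor g he
      · obtain ⟨j, q, hji, hc, hq, hqt, hall⟩ := ht.exists_lower hM hC hπ hd
        obtain ⟨σ, hσ⟩ := ih _ (by have := hq.2; omega) i q rfl hqt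
        refine ⟨σ, fun e he => ?_⟩
        obtain ⟨e', he', hee⟩ := hall e he
        have hqd : d ∈ X.panel j q := X.mem_panel_iff.2 (Or.inr hq.1)
        have hee' : e ∈ X.panel j e' := X.mem_panel_iff.2 (Or.inr hee.1)
        rw [hstep j e' e hee, hstep j q d hq, hσ e' he', col.color_recolor_of_ne hji,
          col.color_eq_of_mem_panel hji he', col.color_eq_of_mem_panel hji he,
          ← col.color_eq_of_mem_panel hji.symm hee']
        exact (col.recolor_recolor_comm hM hji.symm hc _ _ _).symm
  have hloc : ∀ (i : I) (d : Δ), ∃ σ : Equiv.Perm (Ω i),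
      (∀ e ∈ X.panel i d, h e = col.recolor i (h d) (σ (col.color i e))) ∧
        (X.IsTransverse C i d (π d) ∨ σ ∈ F i) := by
    intro i d
    by_cases ht : X.IsTransverse C i d (π d)
    · obtain ⟨σ, hσ⟩ := htrans _ i d rfl ht
      exact ⟨σ, hσ, Or.inl ht⟩
    · obtain ⟨p, hpd, hp⟩ := Building.exists_isLower_of_not_isTransverse hM hC hπ ht
      have h1 : ∀ e ∈ X.panel i d, h e =
          col.recolor i (h p) (f i (col.color i p) (col.color i (h p)) (col.color i e)) := by
        intro e he
        by_cases hep : e = p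
        · rw [hep, hfab i _ _ (hharm _ p rfl i)]
          exact (col.recolor_color_of_mem (X.mem_panel_self i _)).symm
        · exact hstep i p e (hp e he hep)
      refine ⟨_, fun e he => ?_, Or.inr (hfF i (col.color i p) (col.color i (h p)))⟩
      rw [h1 e he]
      refine (col.recolor_eq_of_mem ?_ _).symm
      rw [h1 d (X.mem_panel_self i d)]
      exact col.recolor_mem i _ _
  obtain ⟨a, ha⟩ := col.mem_aut_of_local h fun i d => (hloc i d).imp fun σ hσ => hσ.1
  refine ⟨a, fun c hc => (ha c).trans (hC' c hc), ?_, fun c => ha c ▸ hharm _ c rfl⟩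
  rintro i P hP
  obtain ⟨d, rfl⟩ := id hP
  obtain ⟨σ, hσ, h1 | h1⟩ := hloc i d
  · exact Or.inl ⟨i, X.panel i (π d), X.isPanel_panel i _, h1.2.2, h1.parallel hM hC (hπ d)⟩
  · right
    rw [col.localAction_eq a hP (σ := σ) fun e he => by rw [ha, ha, hσ e he]]
    exact h1
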